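/- Let $W=(W_t)_{t\ge 0}$ be a standard one-dimensional Brownian motion, started at $0$, on a probability space $(\Omega,\mathcal A,P)$ (for instance the coordinate process on the path space $C(\mathbb R^+,\mathbb R)$ under Wiener measure). Let $(\mathcal F_t)_{t\ge0}$ be the usual $P$-augmentation of the filtration generated by $W$, that is, $\mathcal F_t=\bigcap_{s>t}\sigma\big(\{W_u:u\le s\}\cup\mathcal N\big)$, where $\mathcal N$ is the family of all $P$-null sets of the $P$-completion of $\mathcal A$. Fix $a>0$ and let $\mathcal F'_t=\mathcal F_{t+a}$, $t\ge 0$, be the look-ahead filtration. Then $W$ is not a semimartingale in the filtration $(\mathcal F'_t)_{t\ge0}$. Here a process $X$ is a semimartingale in a filtration $(\mathcal G_t)$ if it is $(\mathcal G_t)$-adapted and can be written, up to indistinguishability, as $X=X_0+M+A$, where $M$ is a càdlàg $(\mathcal G_t)$-local martingale with $M_0=0$, and $A$ is a càdlàg $(\mathcal G_t)$-adapted process with $A_0=0$ whose paths have finite variation on compact intervals. -/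

import Mathlib

open MeasureTheory ProbabilityTheory Filter Topology
open scoped NNReal ENNReal

namespace Foresight

/-- A path `f : [0, ∞) → ℝ` is càdlàg: right-continuous with finite left limits. -/
def IsCadlag (f : ℝ≥0 → ℝ) : Prop :=
  ∀ t, ContinuousWithinAt f (Set.Ioi t) t ∧ ∃ l : ℝ, Tendsto f (𝓝[<] t) (𝓝 l)

section Semimartingale

/-- `M` is a local martingale null at `0`: it is adapted, a.s. càdlàg, starts from `0`, and there
are stopping times `τ n`, a.s. increasing to infinity, such that each process
`M` stopped at `τ n` is a martingale. -/
structure IsLocalMartingaleNull {Ω : Type*} {m : MeasurableSpace Ω} (M : ℝ≥0 → Ω → ℝ)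
    (𝓕 : Filtration ℝ≥0 m) (P : Measure Ω) : Prop where
  adapted : StronglyAdapted 𝓕 M
  cadlag : ∀ᵐ ω ∂P, IsCadlag (fun t => M t ω)
  zero : ∀ᵐ ω ∂P, M 0 ω = 0
  locally_martingale : Locally (fun Y : ℝ≥0 → Ω → ℝ => Martingale Y 𝓕 P) 𝓕 M P

/-- `A` is a finite-variation process null at `0`: it is adapted, a.s. càdlàg, starts from `0`,
and a.s. its path has bounded variation on every compact interval. -/
structure IsFiniteVariationNull {Ω : Type*} {m : MeasurableSpace Ω} (A : ℝ≥0 → Ω → ℝ)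
    (𝓕 : Filtration ℝ≥0 m) (P : Measure Ω) : Prop where
  adapted : StronglyAdapted 𝓕 A
  cadlag : ∀ᵐ ω ∂P, IsCadlag (fun t => A t ω)
  zero : ∀ᵐ ω ∂P, A 0 ω = 0
  finite_variation : ∀ᵐ ω ∂P, LocallyBoundedVariationOn (fun t => A t ω) Set.univ

/-- `X` is a semimartingale: it is adapted and, up to indistinguishability,
`X = X₀ + M + A` with `M` a local martingale null at `0` and `A` a finite-variation process
null at `0`. -/
def IsSemimartingale {Ω : Type*} {m : MeasurableSpace Ω} (X : ℝ≥0 → Ω → ℝ)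
    (𝓕 : Filtration ℝ≥0 m) (P : Measure Ω) : Prop :=
  StronglyAdapted 𝓕 X ∧ ∃ M A : ℝ≥0 → Ω → ℝ,
    IsLocalMartingaleNull M 𝓕 P ∧ IsFiniteVariationNull A 𝓕 P ∧
      ∀ᵐ ω ∂P, ∀ t, X t ω = X 0 ω + M t ω + A t ω

end Semimartingale

section Filtrations

/-- The filtration `t ↦ σ(W u : u ≤ t) ∨ {P-null sets}`, on the `P`-completion of `Ω`. Null sets
are all subsets of `Ω` of outer measure `0`. -/
def completedFiltration {Ω : Type*} [MeasurableSpace Ω] (W : ℝ≥0 → Ω → ℝ) (P : Measure Ω)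
    (hW : ∀ t, AEMeasurable (W t) P) :
    Filtration ℝ≥0 (inferInstance : MeasurableSpace (NullMeasurableSpace Ω P)) where
  seq t := (⨆ u ≤ t, MeasurableSpace.comap (W u) inferInstance) ⊔
    MeasurableSpace.generateFrom {N : Set Ω | P N = 0}
  mono' _ _ hst := sup_le_sup_right (biSup_mono fun _ hu => hu.trans hst) _
  le' t := by
    refine sup_le (iSup₂_le fun u _ => ?_) (MeasurableSpace.generateFrom_le fun N hN => ?_)
    · rintro _ ⟨B, hB, rfl⟩
      exact (hW u).nullMeasurable hB
    · exact NullMeasurableSet.of_null hN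

/-- The usual `P`-augmentation of the filtration generated by `W`:
`𝓕 t = ⋂ s > t, σ(W u : u ≤ s) ∨ {P-null sets}`. -/
noncomputable def usualAugmentation {Ω : Type*} [MeasurableSpace Ω] (W : ℝ≥0 → Ω → ℝ)
    (P : Measure Ω) (hW : ∀ t, AEMeasurable (W t) P) :
    Filtration ℝ≥0 (inferInstance : MeasurableSpace (NullMeasurableSpace Ω P)) :=
  (completedFiltration W P hW).rightCont

/-- The look-ahead filtration `t ↦ 𝓕 (t + a)`. -/
def lookAhead {Ω : Type*} {m : MeasurableSpace Ω} (𝓕 : Filtration ℝ≥0 m) (a : ℝ≥0) :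
    Filtration ℝ≥0 m where
  seq t := 𝓕 (t + a)
  mono' _ _ hst := 𝓕.mono (add_le_add_left hst a)
  le' t := 𝓕.le (t + a)

end Filtrations

end Foresight

/-! On a grid of `[0, a]` with mesh at most `a`, the look-ahead filtration knows at each grid point
the sign of the next increment of `W`. Betting on that sign is an adapted strategy bounded by one,
and its gain is the variation of `W` along the grid. This tends to infinity in probability, since
its mean grows like `√n` while its variance stays bounded
(`IsPreBrownianReal.tendsto_measureReal_variation`).

For a semimartingale such gains are bounded in probability, uniformly in grid and strategy
(`IsSemimartingale.exists_measureReal_transform_le`). The finite-variation part is controlled by its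
total variation. The local martingale part, after localization, is a martingale that is merely
integrable, so an `L²` isometry is not available; Burkholder's weak-type bound
`measureReal_martingaleTransform_le` replaces it, proved by truncation and Doob decomposition. -/

namespace Foresight

/-! ### Weak-type bounds for discrete martingale transforms -/

section MartingaleTransform

variable {Ω : Type*} {m₀ : MeasurableSpace Ω} {μ : Measure Ω}
  {𝒢 : Filtration ℕ m₀} {H S Y Z : ℕ → Ω → ℝ} {c : ℝ}

lemma MemLp.mul_top {f g : Ω → ℝ} (hf : MemLp f ∞ μ) (hg : MemLp g ∞ μ) :
    MemLp (f * g) ∞ μ := hg.mul hf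

lemma MemLp.integrable_sq_top [IsFiniteMeasure μ] {f : Ω → ℝ} (hf : MemLp f ∞ μ) :
    Integrable (fun ω => f ω ^ 2) μ :=
  ((MemLp.mul_top hf hf).integrable le_top).congr <| ae_of_all _ fun ω => (pow_two (f ω)).symm

/-- An innovation is orthogonal to the past. -/
lemma integral_mul_sub_condExp [IsFiniteMeasure μ] {m : MeasurableSpace Ω} (hm : m ≤ m₀) {f g : Ω → ℝ}
    (hf : StronglyMeasurable[m] f) (hfb : MemLp f ∞ μ) (hg : MemLp g ∞ μ) :
    ∫ ω, f ω * (g ω - (μ[g | m]) ω) ∂μ = 0 := by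
  have hc : MemLp (μ[g | m]) ∞ μ := hg.condExp le_top
  have h1 : Integrable (f * g) μ := (MemLp.mul_top hfb hg).integrable le_top
  have h2 : Integrable (f * μ[g | m]) μ := (MemLp.mul_top hfb hc).integrable le_top
  have h := integral_congr_ae (condExp_mul_of_stronglyMeasurable_left hf h1 (hg.integrable le_top))
  rw [integral_condExp hm] at h
  simp_rw [mul_sub]
  exact (integral_sub h1 h2).trans (sub_eq_zero.2 h)

/-- The martingale part of the transform of `Z` by `H`. -/
noncomputable def innovationTransform (𝒢 : Filtration ℕ m₀) (μ : Measure Ω) (H Z : ℕ → Ω → ℝ)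
    (n : ℕ) (ω : Ω) : ℝ :=
  ∑ k ∈ Finset.range n, H k ω * (Z (k + 1) ω - (μ[Z (k + 1) | 𝒢 k]) ω)

lemma memLp_top_of_mem_Icc (hZ : StronglyAdapted 𝒢 Z) (h0 : ∀ k ω, 0 ≤ Z k ω)
    (hc : ∀ k ω, Z k ω ≤ c) (k : ℕ) : MemLp (Z k) ∞ μ :=
  memLp_top_of_bound ((hZ k).mono (𝒢.le k)).aestronglyMeasurable c <| ae_of_all _ fun ω => by
    rw [Real.norm_eq_abs, abs_of_nonneg (h0 k ω)]; exact hc k ω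

lemma memLp_top_of_abs_le_one (hH : StronglyAdapted 𝒢 H) (hH1 : ∀ k ω, |H k ω| ≤ 1) (k : ℕ) :
    MemLp (H k) ∞ μ :=
  memLp_top_of_bound ((hH k).mono (𝒢.le k)).aestronglyMeasurable 1 <| ae_of_all _ (hH1 k)

lemma memLp_innovationTransform (hH : ∀ k, MemLp (H k) ∞ μ) (hZ : ∀ k, MemLp (Z k) ∞ μ) (n : ℕ) :
    MemLp (innovationTransform 𝒢 μ H Z n) ∞ μ :=
  memLp_finsetSum (Finset.range n) fun k _ =>
    MemLp.mul_top (hH k) ((hZ (k + 1)).sub ((hZ (k + 1)).condExp le_top))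

lemma stronglyAdapted_innovationTransform (hH : StronglyAdapted 𝒢 H) (hZ : StronglyAdapted 𝒢 Z) :
    StronglyAdapted 𝒢 (innovationTransform 𝒢 μ H Z) := by
  intro n
  refine Finset.stronglyMeasurable_fun_sum _ fun k hk => ?_
  have hk : k + 1 ≤ n := Finset.mem_range.1 hk
  exact ((hH k).mono (𝒢.mono (by omega))).mul (((hZ (k + 1)).mono (𝒢.mono hk)).sub
    (stronglyMeasurable_condExp.mono (𝒢.mono (by omega))))

/-- Second moment bound for the martingale part of a transform of a bounded supermartingale. -/
lemma integral_sq_innovationTransform_le [IsFiniteMeasure μ] (hZ : Supermartingale Z 𝒢 μ) (hH : StronglyAdapted 𝒢 H)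
    (hH1 : ∀ k ω, |H k ω| ≤ 1) (h0 : ∀ k ω, 0 ≤ Z k ω) (hc : ∀ k ω, Z k ω ≤ c) (n : ℕ) :
    ∫ ω, innovationTransform 𝒢 μ H Z n ω ^ 2 ∂μ ≤
      ∫ ω, Z n ω ^ 2 ∂μ + 2 * c * (∫ ω, Z 0 ω ∂μ - ∫ ω, Z n ω ∂μ) := by
  have bZ := memLp_top_of_mem_Icc (μ := μ) hZ.stronglyAdapted h0 hc
  have bH := memLp_top_of_abs_le_one (μ := μ) hH hH1
  have bU := memLp_innovationTransform (𝒢 := 𝒢) bH bZ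
  have aU := stronglyAdapted_innovationTransform (μ := μ) hH hZ.stronglyAdapted
  induction n with
  | zero =>
    simp only [innovationTransform, Finset.range_zero, Finset.sum_empty]
    simp only [ne_eq, OfNat.ofNat_ne_zero, not_false_eq_true, zero_pow, integral_zero, sub_self,
      mul_zero, add_zero]
    exact integral_nonneg fun ω => sq_nonneg _
  | succ n ih =>
    set U := innovationTransform 𝒢 μ H Z
    set e : Ω → ℝ := μ[Z (n + 1) | 𝒢 n] with he
    have be : MemLp e ∞ μ := (bZ (n + 1)).condExp le_top
    have bd : MemLp (Z (n + 1) - e) ∞ μ := (bZ (n + 1)).sub be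
    have cross : ∫ ω, (U n ω * H n ω) * (Z (n + 1) ω - e ω) ∂μ = 0 :=
      integral_mul_sub_condExp (𝒢.le n) ((aU n).mul (hH n)) (MemLp.mul_top (bU n) (bH n))
        (bZ (n + 1))
    have cross' : ∫ ω, e ω * (Z (n + 1) ω - e ω) ∂μ = 0 :=
      integral_mul_sub_condExp (𝒢.le n) stronglyMeasurable_condExp be (bZ (n + 1))
    have icross := (MemLp.mul_top (MemLp.mul_top (bU n) (bH n)) bd).integrable le_top
    have icross' := (MemLp.mul_top be bd).integrable le_top
    have hle : e ≤ᵐ[μ] Z n := hZ.condExp_ae_le n.le_succ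
    have ie : ∫ ω, e ω ∂μ = ∫ ω, Z (n + 1) ω ∂μ := integral_condExp (𝒢.le n)
    have iZ k : Integrable (Z k) μ := hZ.integrable k
    have iei : Integrable e μ := be.integrable le_top
    -- With `d = Z (n + 1) - e`, one has `d² = Z (n + 1)² - 2ed - e²`, and `Z n² - e² ≤ 2c (Z n -
    -- e)` because `e ≤ Z n ≤ c`. Both terms linear in `d` integrate to zero and the rest
    -- telescopes.
    have step : ∫ ω, U (n + 1) ω ^ 2 ∂μ ≤ ∫ ω, (U n ω ^ 2
        + 2 * ((U n ω * H n ω) * (Z (n + 1) ω - e ω)) + Z (n + 1) ω ^ 2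
        - 2 * (e ω * (Z (n + 1) ω - e ω)) - Z n ω ^ 2 + 2 * c * (Z n ω - e ω)) ∂μ := by
      have j1 := (MemLp.integrable_sq_top (bU n)).add (icross.const_mul 2)
      have j2 := ((j1.add (MemLp.integrable_sq_top (bZ (n + 1)))).sub (icross'.const_mul 2)).sub (MemLp.integrable_sq_top (bZ n))
      refine integral_mono_ae (MemLp.integrable_sq_top (bU (n + 1))) (j2.add (((iZ n).sub iei).const_mul (2 * c))) ?_
      filter_upwards [hle] with ω hω
      have hU : U (n + 1) ω = U n ω + H n ω * (Z (n + 1) ω - e ω) := by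
        simp [U, innovationTransform, Finset.sum_range_succ, he]
      have hh : H n ω ^ 2 ≤ 1 := (sq_le_one_iff_abs_le_one _).2 (hH1 n ω)
      have h1 := mul_le_mul_of_nonneg_right hh (sq_nonneg (Z (n + 1) ω - e ω))
      have h2 := mul_nonneg (sub_nonneg.2 (hc n ω)) (sub_nonneg.2 hω)
      have h3 := sq_nonneg (Z n ω - e ω)
      rw [hU]
      nlinarith
    rw [integral_add, integral_sub, integral_sub, integral_add, integral_add, integral_const_mul,
      integral_const_mul, integral_const_mul, integral_sub (iZ n) iei, cross, cross', ie] at step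
    · linarith
    · exact MemLp.integrable_sq_top (bU n)
    · exact icross.const_mul 2
    · exact (MemLp.integrable_sq_top (bU n)).add (icross.const_mul 2)
    · exact MemLp.integrable_sq_top (bZ (n + 1))
    · exact ((MemLp.integrable_sq_top (bU n)).add (icross.const_mul 2)).add (MemLp.integrable_sq_top (bZ (n + 1)))
    · exact icross'.const_mul 2
    · exact (((MemLp.integrable_sq_top (bU n)).add (icross.const_mul 2)).add (MemLp.integrable_sq_top (bZ (n + 1)))).sub
        (icross'.const_mul 2)
    · exact MemLp.integrable_sq_top (bZ n)
    · exact ((((MemLp.integrable_sq_top (bU n)).add (icross.const_mul 2)).add (MemLp.integrable_sq_top (bZ (n + 1)))).sub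
        (icross'.const_mul 2)).sub (MemLp.integrable_sq_top (bZ n))
    · exact ((iZ n).sub iei).const_mul (2 * c)

/-- Truncation makes a nonnegative martingale bounded, hence square integrable, at the price of a
drift. -/
lemma supermartingale_min_const [IsFiniteMeasure μ] (hS : Martingale S 𝒢 μ) (c : ℝ) :
    Supermartingale (fun k ω => min (S k ω) c) 𝒢 μ := by
  have hi k : Integrable (fun ω => min (S k ω) c) μ := (hS.integrable k).inf (integrable_const c)
  refine ⟨fun k => (continuous_id.min continuous_const).comp_stronglyMeasurable
    (hS.stronglyMeasurable k), fun i j hij => ?_, hi⟩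
  have h1 := condExp_mono (m := 𝒢 i) (hi j) (hS.integrable j)
    (ae_of_all μ fun ω => min_le_left (S j ω) c)
  have h2 := condExp_mono (m := 𝒢 i) (hi j) (integrable_const c)
    (ae_of_all μ fun ω => min_le_right (S j ω) c)
  rw [condExp_const (𝒢.le i)] at h2
  filter_upwards [h1, h2, hS.condExp_ae_eq hij] with ω h1 h2 h3
  exact le_min (h1.trans_eq h3) h2

/-- Weak-type inequality for transforms of nonnegative martingales. -/
lemma measureReal_le_of_nonneg_martingale [IsFiniteMeasure μ] (hS : Martingale S 𝒢 μ) (hH : StronglyAdapted 𝒢 H)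
    (hH1 : ∀ k ω, |H k ω| ≤ 1) (h0 : ∀ k ω, 0 ≤ S k ω) (hc : 0 < c) (n : ℕ) :
    c * μ.real {ω | 2 * c ≤ |∑ k ∈ Finset.range n, H k ω * (S (k + 1) ω - S k ω)|} ≤
      4 * ∫ ω, S n ω ∂μ := by
  set Z : ℕ → Ω → ℝ := fun k ω => min (S k ω) c with hZdef
  have hZ : Supermartingale Z 𝒢 μ := supermartingale_min_const hS c
  have hZ0 k ω : 0 ≤ Z k ω := le_min (h0 k ω) hc.le
  have hZc k ω : Z k ω ≤ c := min_le_right _ _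
  have bZ := memLp_top_of_mem_Icc (μ := μ) hZ.stronglyAdapted hZ0 hZc
  have bU := memLp_innovationTransform (𝒢 := 𝒢) (memLp_top_of_abs_le_one (μ := μ) hH hH1) bZ
  have hmean k : ∫ ω, S k ω ∂μ = ∫ ω, S n ω ∂μ := by
    have key i j (hij : i ≤ j) : ∫ ω, S i ω ∂μ = ∫ ω, S j ω ∂μ := by
      simpa using hS.setIntegral_eq hij MeasurableSet.univ
    rcases le_total k n with h | h
    · exact key _ _ h
    · exact (key _ _ h).symm
  set U := innovationTransform 𝒢 μ H Z n
  set D : Ω → ℝ := fun ω => ∑ k ∈ Finset.range n, (Z k ω - (μ[Z (k + 1) | 𝒢 k]) ω)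
  -- Off `A₁` the truncation is inactive up to time `n`, so the transform is `U` minus a drift term
  -- bounded by `D`; off `A₂` and `A₃` each is below `c`. The three events cost 1, 2 and 1 times `∫
  -- S n`, hence the factor 4.
  set A₁ := {ω | c ≤ (Finset.range (n + 1)).sup' Finset.nonempty_range_add_one fun k => S k ω}
  set A₂ := {ω | c ^ 2 ≤ U ω ^ 2}
  set A₃ := {ω | c ≤ D ω}
  have hD0 : ∀ᵐ ω ∂μ, ∀ k, (μ[Z (k + 1) | 𝒢 k]) ω ≤ Z k ω :=
    ae_all_iff.2 fun k => hZ.condExp_ae_le k.le_succ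
  have hsub : {ω | 2 * c ≤ |∑ k ∈ Finset.range n, H k ω * (S (k + 1) ω - S k ω)|} ≤ᵐ[μ]
      (A₁ ∪ (A₂ ∪ A₃) : Set Ω) := by
    filter_upwards [hD0] with ω hω h
    change 2 * c ≤ |∑ k ∈ Finset.range n, H k ω * (S (k + 1) ω - S k ω)| at h
    change ω ∈ A₁ ∪ (A₂ ∪ A₃)
    by_contra hcon
    simp only [Set.mem_union, not_or] at hcon
    obtain ⟨h1, h2, h3⟩ := hcon
    simp only [A₁, A₂, A₃, Set.mem_ofPred_eq, not_le, Finset.sup'_lt_iff, Finset.mem_range]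
      at h1 h2 h3
    have hSZ : ∀ k, k < n + 1 → S k ω = Z k ω := fun k hk => (min_eq_left (h1 k hk).le).symm
    have hsplit : ∑ k ∈ Finset.range n, H k ω * (S (k + 1) ω - S k ω) =
        U ω - ∑ k ∈ Finset.range n, H k ω * (Z k ω - (μ[Z (k + 1) | 𝒢 k]) ω) := by
      simp only [U, innovationTransform]
      rw [← Finset.sum_sub_distrib]
      refine Finset.sum_congr rfl fun k hk => ?_
      have hk := Finset.mem_range.1 hk
      rw [hSZ k (by omega), hSZ (k + 1) (by omega)]
      ring
    have hHD : |∑ k ∈ Finset.range n, H k ω * (Z k ω - (μ[Z (k + 1) | 𝒢 k]) ω)| ≤ D ω := by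
      refine (Finset.abs_sum_le_sum_abs _ _).trans (Finset.sum_le_sum fun k _ => ?_)
      rw [abs_mul, abs_of_nonneg (sub_nonneg.2 (hω k))]
      exact mul_le_of_le_one_left (sub_nonneg.2 (hω k)) (hH1 k ω)
    have hU : |U ω| < c := by
      have := sq_lt_sq.1 h2
      rwa [abs_of_pos hc] at this
    rw [hsplit] at h
    have := abs_sub (U ω) (∑ k ∈ Finset.range n, H k ω * (Z k ω - (μ[Z (k + 1) | 𝒢 k]) ω))
    linarith
  have b1 : c * μ.real A₁ ≤ ∫ ω, S n ω ∂μ := by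
    have h := maximal_ineq hS.submartingale (fun k ω => h0 k ω) (ε := ⟨c, hc.le⟩) n
    have h' := ENNReal.toReal_mono ENNReal.ofReal_ne_top h
    rw [ENNReal.toReal_mul, ENNReal.toReal_ofReal
      (integral_nonneg fun ω => h0 n ω)] at h'
    exact h'.trans (setIntegral_le_integral (hS.integrable n) (ae_of_all _ (h0 n)))
  have iZ k : ∫ ω, Z k ω ∂μ ≤ ∫ ω, S n ω ∂μ := (hmean k) ▸
    integral_mono (hZ.integrable k) (hS.integrable k) fun ω => min_le_left _ _
  have iZ0 k : 0 ≤ ∫ ω, Z k ω ∂μ := integral_nonneg (hZ0 k)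
  have b2 : c * μ.real A₂ ≤ 2 * ∫ ω, S n ω ∂μ := by
    have h1 := mul_meas_ge_le_integral_of_nonneg (ae_of_all μ fun ω => sq_nonneg (U ω))
      (MemLp.integrable_sq_top (bU n)) (c ^ 2)
    have h2 := integral_sq_innovationTransform_le hZ hH hH1 hZ0 hZc n
    have h3 : ∫ ω, Z n ω ^ 2 ∂μ ≤ c * ∫ ω, Z n ω ∂μ := by
      rw [← integral_const_mul]
      refine integral_mono (MemLp.integrable_sq_top (bZ n)) ((hZ.integrable n).const_mul c) fun ω => ?_
      have := mul_le_mul_of_nonneg_right (hZc n ω) (hZ0 n ω)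
      simpa [pow_two] using this
    refine le_of_mul_le_mul_left ?_ hc
    have h4 := mul_nonneg hc.le (iZ0 n)
    have h5 := mul_le_mul_of_nonneg_left (iZ 0) hc.le
    calc c * (c * μ.real A₂) = c ^ 2 * μ.real A₂ := by ring
      _ ≤ _ := h1
      _ ≤ _ := h2
      _ ≤ c * (2 * ∫ ω, S n ω ∂μ) := by linarith
  have b3 : c * μ.real A₃ ≤ ∫ ω, S n ω ∂μ := by
    have hi k : Integrable (fun ω => Z k ω - (μ[Z (k + 1) | 𝒢 k]) ω) μ :=
      (hZ.integrable k).sub integrable_condExp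
    have hD : 0 ≤ᵐ[μ] D := by
      filter_upwards [hD0] with ω hω using Finset.sum_nonneg fun k _ => sub_nonneg.2 (hω k)
    have h1 := mul_meas_ge_le_integral_of_nonneg hD (integrable_finsetSum _ fun k _ => hi k) c
    refine h1.trans ?_
    rw [integral_finsetSum _ fun k _ => hi k]
    have : ∀ k ∈ Finset.range n, ∫ ω, (Z k ω - (μ[Z (k + 1) | 𝒢 k]) ω) ∂μ =
        ∫ ω, Z k ω ∂μ - ∫ ω, Z (k + 1) ω ∂μ := fun k _ => by
      rw [integral_sub (hZ.integrable k) integrable_condExp, integral_condExp (𝒢.le k)]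
    rw [Finset.sum_congr rfl this, Finset.sum_range_sub' (fun k => ∫ ω, Z k ω ∂μ)]
    linarith [iZ 0, iZ0 n]
  have hm : μ.real {ω | 2 * c ≤ |∑ k ∈ Finset.range n, H k ω * (S (k + 1) ω - S k ω)|} ≤
      μ.real A₁ + (μ.real A₂ + μ.real A₃) := by
    refine (ENNReal.toReal_mono (measure_ne_top μ _) (measure_mono_ae hsub)).trans ?_
    refine (measureReal_union_le _ _).trans ?_
    gcongr
    exact measureReal_union_le _ _
  have := mul_le_mul_of_nonneg_left hm hc.le
  linarith

/-- **Burkholder's weak-type inequality** for martingale transforms. -/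
theorem measureReal_martingaleTransform_le [IsFiniteMeasure μ] (hY : Martingale Y 𝒢 μ) (hH : StronglyAdapted 𝒢 H)
    (hH1 : ∀ k ω, |H k ω| ≤ 1) (hc : 0 < c) (n : ℕ) :
    c * μ.real {ω | 4 * c ≤ |∑ k ∈ Finset.range n, H k ω * (Y (k + 1) ω - Y k ω)|} ≤
      8 * ∫ ω, |Y n ω| ∂μ := by
  -- A version of the conditional expectation that is nonnegative everywhere, as the previous bound
  -- requires. Applied to the positive and negative parts of `Y n`, it doubles both constants.
  set T : (Ω → ℝ) → ℕ → Ω → ℝ := fun f k ω => max ((μ[f | 𝒢 k]) ω) 0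
  have hTe {f : Ω → ℝ} (hf : 0 ≤ f) (k : ℕ) : T f k =ᵐ[μ] μ[f | 𝒢 k] := by
    filter_upwards [condExp_nonneg (m := 𝒢 k) (ae_of_all μ hf)] with ω hω using max_eq_left hω
  have hT {f : Ω → ℝ} (hf : 0 ≤ f) : Martingale (T f) 𝒢 μ := by
    refine ⟨fun k => (continuous_id.max continuous_const).comp_stronglyMeasurable
      stronglyMeasurable_condExp, fun i j hij => ?_⟩
    exact ((condExp_congr_ae (hTe hf j)).trans
      ((martingale_condExp f 𝒢 μ).condExp_ae_eq hij)).trans (hTe hf i).symm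
  have hTi {f : Ω → ℝ} (hf : 0 ≤ f) (hfY : ∀ ω, f ω ≤ |Y n ω|) (hfi : Integrable f μ) :
      ∫ ω, T f n ω ∂μ ≤ ∫ ω, |Y n ω| ∂μ := by
    rw [integral_congr_ae (hTe hf n), integral_condExp (𝒢.le n)]
    exact integral_mono hfi (hY.integrable n).abs hfY
  set p : Ω → ℝ := fun ω => max (Y n ω) 0
  set q : Ω → ℝ := fun ω => max (-Y n ω) 0
  have hp : 0 ≤ p := fun ω => le_max_right _ _
  have hq : 0 ≤ q := fun ω => le_max_right _ _
  have ip : Integrable p μ := (hY.integrable n).pos_part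
  have iq : Integrable q μ := (hY.integrable n).neg_part
  have hpq : Y n = p - q := funext fun ω => (max_zero_sub_max_neg_zero_eq_self (Y n ω)).symm
  have bp := (measureReal_le_of_nonneg_martingale (hT hp) hH hH1
    (fun k ω => le_max_right _ _) hc n).trans (mul_le_mul_of_nonneg_left
      (hTi hp (fun ω => max_le (le_abs_self _) (abs_nonneg _)) ip) (by norm_num))
  have bq := (measureReal_le_of_nonneg_martingale (hT hq) hH hH1
    (fun k ω => le_max_right _ _) hc n).trans (mul_le_mul_of_nonneg_left
      (hTi hq (fun ω => max_le (neg_le_abs _) (abs_nonneg _)) iq) (by norm_num))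
  have hdec : ∀ᵐ ω ∂μ, ∀ k ∈ Finset.range (n + 1), Y k ω = T p k ω - T q k ω := by
    refine (Finset.eventually_all _).2 fun k hk => ?_
    have h1 := hY.condExp_ae_eq (Nat.lt_succ_iff.1 (Finset.mem_range.1 hk))
    rw [hpq] at h1
    filter_upwards [h1, condExp_sub ip iq (𝒢 k), hTe hp k, hTe hq k] with ω h1 h2 h3 h4
    rw [← h1, h2, h3, h4, Pi.sub_apply]
  set E : (ℕ → Ω → ℝ) → Ω → ℝ :=
    fun X ω => ∑ k ∈ Finset.range n, H k ω * (X (k + 1) ω - X k ω)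
  have hsub : {ω | 4 * c ≤ |E Y ω|} ≤ᵐ[μ]
      ({ω | 2 * c ≤ |E (T p) ω|} ∪ {ω | 2 * c ≤ |E (T q) ω|} : Set Ω) := by
    filter_upwards [hdec] with ω hω h
    change 4 * c ≤ |E Y ω| at h
    change 2 * c ≤ |E (T p) ω| ∨ 2 * c ≤ |E (T q) ω|
    have : E Y ω = E (T p) ω - E (T q) ω := by
      simp only [E]
      rw [← Finset.sum_sub_distrib]
      refine Finset.sum_congr rfl fun k hk => ?_
      have hk := Finset.mem_range.1 hk
      rw [hω k (Finset.mem_range.2 (by omega)), hω (k + 1) (Finset.mem_range.2 (by omega))]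
      ring
    by_contra! hcon
    have := abs_sub (E (T p) ω) (E (T q) ω)
    grind
  have hm := (ENNReal.toReal_mono (measure_ne_top μ _) (measure_mono_ae hsub)).trans
    (measureReal_union_le _ _)
  have := mul_le_mul_of_nonneg_left hm hc.le
  simp only [Measure.real, E] at *
  linarith

end MartingaleTransform

/-! ### Brownian variation along uniform grids -/

section BrownianVariation

variable {Ω : Type*} {m₀ : MeasurableSpace Ω} {P : Measure Ω} {W : ℝ≥0 → Ω → ℝ}

lemma integral_abs_gaussianReal_pos : 0 < ∫ x, |x| ∂(gaussianReal 0 1) := by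
  have hi : Integrable (fun x : ℝ => |x|) (gaussianReal 0 1) :=
    (IsGaussian.hasGaussianLaw_id (μ := gaussianReal 0 1)).integrable.abs
  refine lt_of_le_of_ne (integral_nonneg fun x => abs_nonneg x) fun h => ?_
  have h0 := (integral_eq_zero_iff_of_nonneg (fun x => abs_nonneg x) hi).1 h.symm
  have h1 : (id : ℝ → ℝ) =ᵐ[gaussianReal 0 1] 0 := by
    filter_upwards [h0] with x hx using abs_eq_zero.1 hx
  have h2 := variance_id_gaussianReal (μ := 0) (v := 1)
  rw [variance_congr h1] at h2
  simp at h2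

lemma integral_abs_gaussianReal (v : ℝ≥0) :
    ∫ x, |x| ∂(gaussianReal 0 v) = √v * ∫ x, |x| ∂(gaussianReal 0 1) := by
  have h : (gaussianReal 0 1).map (fun x => √v * x) = gaussianReal 0 v := by
    rw [gaussianReal_map_const_mul]
    congr 1
    · simp
    · ext; simp
  rw [← h, integral_map (by fun_prop) (by fun_prop), ← integral_const_mul]
  simp [abs_mul, abs_of_nonneg (Real.sqrt_nonneg _)]

/-- The variation of a Brownian path along the uniform grid of `[0, a]` tends to infinity in
probability. -/
lemma IsPreBrownianReal.tendsto_measureReal_variation (hW : IsPreBrownianReal W P) {a : ℝ≥0}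
    (ha : 0 < a) (K : ℝ) :
    Tendsto (fun n : ℕ => P.real {ω | ∑ k ∈ Finset.range (n + 1),
      |W ((k + 1 : ℕ) * (a / (n + 1 : ℕ))) ω - W (k * (a / (n + 1 : ℕ))) ω| ≤ K})
      atTop (𝓝 0) := by
  have : IsProbabilityMeasure P := hW.isGaussianProcess.isProbabilityMeasure
  set κ := ∫ x, |x| ∂(gaussianReal 0 1) with hκ
  have κ0 : 0 < κ := integral_abs_gaussianReal_pos
  -- Chebyshev's inequality: the sum has mean `√(n + 1) * (√a * κ)` and variance at most `(n + 1) *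
  -- h = a`.
  have bound (n : ℕ) (hn : K < √(n + 1 : ℕ) * (√a * κ)) :
      P.real {ω | ∑ k ∈ Finset.range (n + 1),
        |W ((k + 1 : ℕ) * (a / (n + 1 : ℕ))) ω - W (k * (a / (n + 1 : ℕ))) ω| ≤ K} ≤
      a / (√(n + 1 : ℕ) * (√a * κ) - K) ^ 2 := by
    set h : ℝ≥0 := a / (n + 1 : ℕ) with hh
    set X : Fin (n + 1) → Ω → ℝ :=
      fun k ω => |W ((k + 1 : ℕ) * h) ω - W ((k : ℕ) * h) ω|
    have hlaw (k : Fin (n + 1)) :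
        HasLaw (fun ω => W ((k + 1 : ℕ) * h) ω - W ((k : ℕ) * h) ω) (gaussianReal 0 h) P := by
      have e : nndist ((k + 1 : ℕ) * h : ℝ≥0).1 ((k : ℕ) * h : ℝ≥0).1 = h := by
        refine NNReal.coe_injective ?_
        simp [add_mul]
      have := hW.hasLaw_sub ((k + 1 : ℕ) * h) ((k : ℕ) * h)
      rw [e] at this
      exact this
    have hindep : iIndepFun X P := by
      have := hW.hasIndepIncrements (n + 1) (fun i => (i : ℕ) * h) fun i j hij => by
        dsimp only
        gcongr
        exact hij
      exact (this.comp (fun _ x => |x|) fun _ => by fun_prop)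
    have hL2 (k) : MemLp (X k) 2 P := (hlaw k).hasGaussianLaw.memLp_two.abs
    have hmean (k) : P[X k] = √h * κ := by
      rw [← integral_abs_gaussianReal]
      exact (hlaw k).integral_comp (f := fun x => |x|) (by fun_prop)
    have hvar (k) : Var[X k; P] ≤ h := by
      rw [variance_eq_sub (hL2 k)]
      have h1 : ∫ ω, (X k ^ 2) ω ∂P = (h : ℝ) := by
        have := variance_of_integral_eq_zero (hlaw k).aemeasurable
          (by rw [(hlaw k).integral_eq, integral_id_gaussianReal])
        rw [(hlaw k).variance_eq, variance_id_gaussianReal] at this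
        rw [this]
        simp [X]
      rw [h1]
      exact sub_le_self _ (sq_nonneg _)
    have hsum : (fun ω => ∑ k ∈ Finset.range (n + 1),
        |W ((k + 1 : ℕ) * h) ω - W (k * h) ω|) = ∑ k, X k := by
      ext ω
      rw [Finset.sum_apply, Fin.sum_univ_eq_sum_range
        (fun k => |W ((k + 1 : ℕ) * h) ω - W (k * h) ω|) (n + 1)]
    have hsL2 : MemLp (∑ k, X k) 2 P := memLp_finsetSum' _ fun k _ => hL2 k
    have hN : (0 : ℝ) < (n + 1 : ℕ) := by positivity
    have hNh : ((n + 1 : ℕ) : ℝ) * h = a := by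
      rw [hh]; push_cast; field_simp
    have hvs : Var[∑ k, X k; P] ≤ a := by
      rw [IndepFun.variance_sum (fun k _ => hL2 k) fun i _ j _ hij => hindep.indepFun hij]
      refine (Finset.sum_le_sum fun k _ => hvar k).trans ?_
      simpa using hNh.le
    have hms : P[∑ k, X k] = √(n + 1 : ℕ) * (√a * κ) := by
      have : P[∑ k, X k] = ∑ k, P[X k] := by
        simp_rw [Finset.sum_apply]
        exact integral_finsetSum _ fun k _ => (hL2 k).integrable one_le_two
      rw [this, Finset.sum_congr rfl fun k _ => hmean k, ← hNh, Real.sqrt_mul hN.le]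
      simp only [Finset.sum_const, Finset.card_univ, Fintype.card_fin, nsmul_eq_mul]
      nth_rewrite 1 [← Real.mul_self_sqrt hN.le]
      ring
    have hd : 0 < √(n + 1 : ℕ) * (√a * κ) - K := sub_pos.2 hn
    have hche := meas_ge_le_variance_div_sq hsL2 hd
    have hsub : {ω | ∑ k ∈ Finset.range (n + 1),
        |W ((k + 1 : ℕ) * h) ω - W (k * h) ω| ≤ K} ⊆
        {ω | √(n + 1 : ℕ) * (√a * κ) - K ≤ |(∑ k, X k) ω - P[∑ k, X k]|} := by
      intro ω hω
      have hω : (∑ k, X k) ω ≤ K := by rw [← hsum]; exact hω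
      change _ ≤ |(∑ k, X k) ω - P[∑ k, X k]|
      rw [hms, abs_sub_comm]
      exact (sub_le_sub_left hω _).trans (le_abs_self _)
    refine (ENNReal.toReal_le_of_le_ofReal (div_nonneg (variance_nonneg _ _) (sq_nonneg _))
      ((measure_mono hsub).trans hche)).trans ?_
    gcongr
  have hlim : Tendsto (fun n : ℕ => √(n + 1 : ℕ) * (√a * κ)) atTop atTop := by
    refine Tendsto.atTop_mul_const (mul_pos (Real.sqrt_pos.2 ha) κ0) ?_
    exact Real.tendsto_sqrt_atTop.comp
      (tendsto_natCast_atTop_atTop.comp (tendsto_add_atTop_nat 1))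
  have hlim' : Tendsto (fun n : ℕ => (a : ℝ) / (√(n + 1 : ℕ) * (√a * κ) - K) ^ 2) atTop (𝓝 0) :=
    Tendsto.div_atTop tendsto_const_nhds
      ((tendsto_pow_atTop two_ne_zero).comp (tendsto_atTop_add_const_right _ (-K) hlim))
  refine squeeze_zero' (Eventually.of_forall fun n => measureReal_nonneg) ?_ hlim'
  filter_upwards [hlim.eventually_gt_atTop K] with n hn using bound n hn

end BrownianVariation

/-! ### Boundedness in probability of elementary integrals -/

section BoundedInProbability

variable {Ω : Type*} {m : MeasurableSpace Ω} {P : Measure Ω} {𝓕 : Filtration ℝ≥0 m}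

/-- The filtration `k ↦ 𝓕 (k * h)`. -/
def gridFiltration (𝓕 : Filtration ℝ≥0 m) (h : ℝ≥0) : Filtration ℕ m where
  seq k := 𝓕 (k * h)
  mono' _ _ hij := 𝓕.mono (by gcongr)
  le' k := 𝓕.le (k * h)

lemma martingale_gridFiltration {Y : ℝ≥0 → Ω → ℝ} (hY : Martingale Y 𝓕 P) (h : ℝ≥0) :
    Martingale (fun k : ℕ => Y (k * h)) (gridFiltration 𝓕 h) P :=
  ⟨fun k => hY.stronglyMeasurable (k * h), fun _ _ hij => hY.condExp_ae_eq (by gcongr)⟩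

/-- The indicators tend to zero almost everywhere, so the measures tend to zero. This serves both
for the localizing times and for the tail of the variation. -/
lemma exists_measureReal_le_of_ae_eventually_notMem [IsFiniteMeasure P] {s : ℕ → Set Ω}
    (hs : ∀ n, MeasurableSet (s n)) (h : ∀ᵐ ω ∂P, ∀ᶠ n in atTop, ω ∉ s n) {ε : ℝ} (hε : 0 < ε) :
    ∃ n, P.real (s n) ≤ ε := by
  have h1 := tendsto_measure_of_ae_tendsto_indicator_of_isFiniteMeasure atTop
    MeasurableSet.empty hs (by
      filter_upwards [h] with ω hω
      filter_upwards [hω] with n hn using by simp [hn])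
  rw [measure_empty] at h1
  have h2 := (ENNReal.tendsto_toReal ENNReal.zero_ne_top).comp h1
  obtain ⟨n, hn⟩ := (h2.eventually_le_const (u := ε) (by simpa using hε)).exists
  exact ⟨n, hn⟩

/-- Sums along uniform grids of increments of a finite-variation process are bounded in
probability. -/
lemma IsFiniteVariationNull.exists_measureReal_le [IsFiniteMeasure P] {A : ℝ≥0 → Ω → ℝ}
    (hA : IsFiniteVariationNull A 𝓕 P) (T : ℝ≥0) {ε : ℝ} (hε : 0 < ε) :
    ∃ C : ℝ, ∀ n : ℕ, P.real {ω | C ≤ ∑ k ∈ Finset.range (n + 1),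
      |A ((k + 1 : ℕ) * (T / (n + 1 : ℕ))) ω - A (k * (T / (n + 1 : ℕ))) ω|} ≤ ε := by
  -- A supremum over countably many grids is measurable, and it is dominated by the variation on
  -- `[0, T]`.
  set V : Ω → ℝ≥0∞ := fun ω => ⨆ n : ℕ, ∑ k ∈ Finset.range (n + 1),
    edist (A ((k + 1 : ℕ) * (T / (n + 1 : ℕ))) ω) (A (k * (T / (n + 1 : ℕ))) ω) with hV
  have hAm t : Measurable (A t) := ((hA.adapted t).mono (𝓕.le t)).measurable
  have hVm : Measurable V := by
    refine Measurable.iSup fun n => Finset.measurable_fun_sum _ fun k _ => ?_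
    exact (hAm _).edist (hAm _)
  have hVfin : ∀ᵐ ω ∂P, V ω < ∞ := by
    filter_upwards [hA.finite_variation] with ω hω
    refine lt_of_le_of_lt (iSup_le fun n => ?_) (hω 0 T trivial trivial).lt_top
    refine eVariationOn.sum_le_of_monotoneOn_Iic (u := fun k : ℕ => k * (T / (n + 1 : ℕ))) ?_ ?_
    · intro i _ j _ hij
      dsimp only
      gcongr
    · refine fun i hi => ⟨trivial, zero_le, ?_⟩
      calc (i : ℝ≥0) * (T / (n + 1 : ℕ)) ≤ (n + 1 : ℕ) * (T / (n + 1 : ℕ)) := by gcongr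
        _ = T := mul_div_cancel₀ _ (by positivity)
  obtain ⟨C, hC⟩ := exists_measureReal_le_of_ae_eventually_notMem
    (s := fun C : ℕ => {ω | (C : ℝ≥0∞) ≤ V ω}) (fun C => measurableSet_le measurable_const hVm) (by
      filter_upwards [hVfin] with ω hω
      obtain ⟨N, hN⟩ := ENNReal.exists_nat_gt hω.ne
      filter_upwards [eventually_ge_atTop N] with n hn
      exact not_le.2 (hN.trans_le (by exact_mod_cast hn))) hε
  refine ⟨C, fun n => (measureReal_mono fun ω hω => ?_).trans hC⟩
  change (C : ℝ≥0∞) ≤ V ω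
  refine le_iSup_of_le n ?_
  have hω : (C : ℝ) ≤ _ := hω
  rw [← ENNReal.ofReal_natCast]
  refine (ENNReal.ofReal_le_ofReal hω).trans_eq ?_
  rw [ENNReal.ofReal_sum_of_nonneg fun _ _ => abs_nonneg _]
  simp_rw [edist_dist, Real.dist_eq]

/-- Elementary stochastic integrals, along uniform grids, of integrands bounded by one against a
semimartingale are bounded in probability. -/
theorem IsSemimartingale.exists_measureReal_transform_le [IsProbabilityMeasure P]
    {X : ℝ≥0 → Ω → ℝ} (hX : IsSemimartingale X 𝓕 P) (T : ℝ≥0) {ε : ℝ} (hε : 0 < ε) :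
    ∃ K : ℝ, ∀ (n : ℕ) (H : ℕ → Ω → ℝ),
      StronglyAdapted (gridFiltration 𝓕 (T / (n + 1 : ℕ))) H → (∀ k ω, |H k ω| ≤ 1) →
      P.real {ω | K ≤ |∑ k ∈ Finset.range (n + 1), H k ω *
        (X ((k + 1 : ℕ) * (T / (n + 1 : ℕ))) ω - X (k * (T / (n + 1 : ℕ))) ω)|} ≤ ε := by
  obtain ⟨-, M, A, hM, hA, hdec⟩ := hX
  obtain ⟨τ, hτ, hmart⟩ := hM.locally_martingale
  obtain ⟨N, hN⟩ := exists_measureReal_le_of_ae_eventually_notMem (P := P)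
    (s := fun n => {ω | τ n ω ≤ T})
    (fun n => 𝓕.le T _ ((hτ.isStoppingTime n).measurableSet_le T)) (by
      filter_upwards [hτ.tendsto_top] with ω hω
      filter_upwards [hω.eventually_const_lt (WithTop.coe_lt_top T)] with n hn
      exact not_le.2 hn) (ε := ε / 3) (by positivity)
  obtain ⟨C, hC⟩ := hA.exists_measureReal_le T (ε := ε / 3) (by positivity)
  set Y := stoppedProcess (fun i ↦ {ω | ⊥ < τ N ω}.indicator (M i)) (τ N) with hYdef
  set I := ∫ ω, |Y T ω| ∂P with hI
  have hI0 : 0 ≤ I := integral_nonneg fun _ => abs_nonneg _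
  -- Chosen so that Burkholder's bound `8 * I / c` is at most `ε / 3`; the `+ 1` keeps `c` positive.
  set c := 24 * (I + 1) / ε with hc
  have hc0 : 0 < c := by positivity
  refine ⟨4 * c + C, fun n H hH hH1 => ?_⟩
  have hYM ω (hω : T < τ N ω) t (ht : t ≤ T) : Y t ω = M t ω := by
    rw [hYdef, stoppedProcess_eq_of_le ((WithTop.coe_le_coe.2 ht).trans hω.le),
      Set.indicator_of_mem (s := {ω | ⊥ < τ N ω}) (bot_le.trans_lt hω)]
  set h := T / (n + 1 : ℕ) with hh
  have hend : ((n + 1 : ℕ) : ℝ≥0) * h = T := mul_div_cancel₀ _ (by positivity)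
  have hgrid {k : ℕ} (hk : k ≤ n + 1) : (k : ℝ≥0) * h ≤ T := by
    rw [← hend]; gcongr
  have hB := measureReal_martingaleTransform_le (martingale_gridFiltration (hmart N) h) hH hH1 hc0
    (n + 1)
  simp only [hend] at hB
  change c * P.real {ω | 4 * c ≤ |∑ k ∈ Finset.range (n + 1),
    H k ω * (Y ((k + 1 : ℕ) * h) ω - Y (k * h) ω)|} ≤ 8 * I at hB
  set E₁ := {ω | 4 * c ≤ |∑ k ∈ Finset.range (n + 1),
    H k ω * (Y ((k + 1 : ℕ) * h) ω - Y (k * h) ω)|}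
  set E₂ := {ω | C ≤ ∑ k ∈ Finset.range (n + 1), |A ((k + 1 : ℕ) * h) ω - A (k * h) ω|}
  set E₃ := {ω | τ N ω ≤ T}
  have hE₁ : P.real E₁ ≤ ε / 3 := by
    refine le_of_mul_le_mul_left (hB.trans ?_) hc0
    rw [hc]
    field_simp
    linarith
  have hsub : {ω | 4 * c + C ≤ |∑ k ∈ Finset.range (n + 1), H k ω *
      (X ((k + 1 : ℕ) * h) ω - X (k * h) ω)|} ≤ᵐ[P] (E₁ ∪ (E₂ ∪ E₃) : Set Ω) := by
    filter_upwards [hdec] with ω hω hlarge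
    change 4 * c + C ≤ |∑ k ∈ Finset.range (n + 1), H k ω *
      (X ((k + 1 : ℕ) * h) ω - X (k * h) ω)| at hlarge
    change ω ∈ E₁ ∪ (E₂ ∪ E₃)
    by_contra hcon
    simp only [Set.mem_union, not_or, E₁, E₂, E₃, Set.mem_ofPred_eq, not_le] at hcon
    obtain ⟨h1, h2, h3⟩ := hcon
    have hsplit : ∑ k ∈ Finset.range (n + 1), H k ω * (X ((k + 1 : ℕ) * h) ω - X (k * h) ω) =
        ∑ k ∈ Finset.range (n + 1), H k ω * (Y ((k + 1 : ℕ) * h) ω - Y (k * h) ω) +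
        ∑ k ∈ Finset.range (n + 1), H k ω * (A ((k + 1 : ℕ) * h) ω - A (k * h) ω) := by
      rw [← Finset.sum_add_distrib]
      refine Finset.sum_congr rfl fun k hk => ?_
      have hk := Finset.mem_range.1 hk
      rw [hYM ω h3 _ (hgrid (by omega)), hYM ω h3 _ (hgrid (by omega)), hω, hω (k * h)]
      ring
    have hAle : |∑ k ∈ Finset.range (n + 1), H k ω * (A ((k + 1 : ℕ) * h) ω - A (k * h) ω)| ≤
        ∑ k ∈ Finset.range (n + 1), |A ((k + 1 : ℕ) * h) ω - A (k * h) ω| := by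
      refine (Finset.abs_sum_le_sum_abs _ _).trans (Finset.sum_le_sum fun k _ => ?_)
      rw [abs_mul]
      exact mul_le_of_le_one_left (abs_nonneg _) (hH1 k ω)
    rw [hsplit] at hlarge
    have := hlarge.trans (abs_add_le _ _)
    linarith
  have hm := (ENNReal.toReal_mono (measure_ne_top P _) (measure_mono_ae hsub)).trans
    ((measureReal_union_le _ _).trans (add_le_add_right (measureReal_union_le _ _) _))
  have := hC n
  simp only [Measure.real] at *
  linarith

end BoundedInProbability

/-! ### Measurability for the look-ahead filtration -/

section LookAhead

variable {Ω : Type*} [MeasurableSpace Ω] {P : Measure Ω} {W : ℝ≥0 → Ω → ℝ}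

lemma measurable_lookAhead_usualAugmentation (hW : ∀ t, AEMeasurable (W t) P) {a s t : ℝ≥0}
    (h : s ≤ t + a) : Measurable[lookAhead (usualAugmentation W P hW) a t] (W s) := by
  have h1 : Measurable[completedFiltration W P hW (t + a)] (W s) := by
    refine Measurable.mono (comap_measurable (W s)) ?_ le_rfl
    exact le_sup_of_le_left
      (le_iSup₂_of_le (f := fun u (_ : u ≤ t + a) => MeasurableSpace.comap (W u) inferInstance)
        s h le_rfl)
  exact h1.mono ((completedFiltration W P hW).le_rightCont (t + a)) le_rfl

instance isProbabilityMeasure_completion [IsProbabilityMeasure P] :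
    IsProbabilityMeasure P.completion :=
  ⟨(Measure.completion_apply P Set.univ).trans measure_univ⟩

end LookAhead

end Foresight

theorem mainTheorem4 {Ω : Type*} [MeasurableSpace Ω] (P : Measure Ω) (W : ℝ≥0 → Ω → ℝ)
    (hW : IsBrownianReal W P) (a : ℝ≥0) (ha : 0 < a) :
    ¬ Foresight.IsSemimartingale (Ω := NullMeasurableSpace Ω P) W
      (Foresight.lookAhead
        (Foresight.usualAugmentation W P hW.toIsPreBrownianReal.aemeasurable) a)
      P.completion := by
  intro hX
  have : IsProbabilityMeasure P := hW.isGaussianProcess.isProbabilityMeasure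
  obtain ⟨K, hK⟩ := hX.exists_measureReal_transform_le a (ε := 1 / 3) (by norm_num)
  obtain ⟨n, hn⟩ := ((Foresight.IsPreBrownianReal.tendsto_measureReal_variation
    hW.toIsPreBrownianReal ha K).eventually_lt_const (u := 1 / 3) (by norm_num)).exists
  set h := a / (n + 1 : ℕ) with hh
  have hle : h ≤ a := by
    rw [hh]
    exact div_le_self zero_le (by simp)
  -- The sign of the coming increment; it is known at time `k * h` because `(k + 1) * h ≤ k * h +
  -- a`.
  set H : ℕ → NullMeasurableSpace Ω P → ℝ :=
    fun k ω => if 0 ≤ W ((k + 1 : ℕ) * h) ω - W (k * h) ω then 1 else -1 with hH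
  have hH1 k ω : |H k ω| ≤ 1 := by
    simp only [hH]
    split_ifs <;> simp
  have key := hK n H (fun k => ?_) hH1
  · have hHW k ω : H k ω * (W ((k + 1 : ℕ) * h) ω - W (k * h) ω) =
        |W ((k + 1 : ℕ) * h) ω - W (k * h) ω| := by
      simp only [hH]
      split_ifs with hpos
      · rw [one_mul, abs_of_nonneg hpos]
      · rw [neg_one_mul, abs_of_neg (not_le.1 hpos)]
    -- The gain equals the variation, which is either at least or at most `K`; each event has
    -- probability at most `1 / 3`, so they cannot cover the space.
    have hcover : (Set.univ : Set Ω) ⊆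
        {ω | K ≤ |∑ k ∈ Finset.range (n + 1), H k ω * (W ((k + 1 : ℕ) * h) ω - W (k * h) ω)|} ∪
        {ω | ∑ k ∈ Finset.range (n + 1), |W ((k + 1 : ℕ) * h) ω - W (k * h) ω| ≤ K} := by
      intro ω _
      have hsum : ∑ k ∈ Finset.range (n + 1), H k ω * (W ((k + 1 : ℕ) * h) ω - W (k * h) ω) =
          ∑ k ∈ Finset.range (n + 1), |W ((k + 1 : ℕ) * h) ω - W (k * h) ω| :=
        Finset.sum_congr rfl fun k _ => hHW k ω
      change K ≤ |∑ k ∈ Finset.range (n + 1), H k ω * _| ∨ _ ≤ K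
      rw [hsum, abs_of_nonneg (Finset.sum_nonneg fun _ _ => abs_nonneg _)]
      exact le_total _ _
    have h1 := (measureReal_mono (μ := P) hcover).trans (measureReal_union_le _ _)
    rw [probReal_univ] at h1
    -- The completion gives every set its `P`-outer measure, so the bound transfers to `P`
    -- unchanged.
    have key' : P.real {ω | K ≤ |∑ k ∈ Finset.range (n + 1),
        H k ω * (W ((k + 1 : ℕ) * h) ω - W (k * h) ω)|} ≤ 1 / 3 := key
    linarith
  · have hm1 : Measurable[Foresight.gridFiltration (Foresight.lookAhead
        (Foresight.usualAugmentation W P hW.toIsPreBrownianReal.aemeasurable) a) h k]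
        (W ((k + 1 : ℕ) * h)) :=
      Foresight.measurable_lookAhead_usualAugmentation _ (by
        push_cast
        rw [add_mul, one_mul]
        gcongr)
    have hm2 : Measurable[Foresight.gridFiltration (Foresight.lookAhead
        (Foresight.usualAugmentation W P hW.toIsPreBrownianReal.aemeasurable) a) h k]
        (W (k * h)) :=
      Foresight.measurable_lookAhead_usualAugmentation _ le_self_add
    exact (Measurable.ite (measurableSet_le measurable_const (hm1.sub hm2)) measurable_const
      measurable_const).stronglyMeasurable
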